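/- Let $\Gamma$ be the free group on two generators $a,b$, let $S=\{a,a^{-1},b,b^{-1}\}$, and let $|w|$ denote the length of the reduced word of $w\in\Gamma$ and, for $w\neq 1$, $t(w)\in S$ its final letter. Let $\Omega$ be the boundary of the Cayley tree of $\Gamma$, that is, the compact space of infinite reduced words $x_1x_2x_3\cdots$ with $x_i\in S$, in the topology of agreement on finite initial segments. Let $\Gamma$ act on $\Omega$ by left multiplication and on $C(\Omega)$ by $\alpha(\gamma)f(\omega)=f(\gamma^{-1}\omega)$. Let $C(\Omega)\rtimes\Gamma$ be the (full) crossed product, that is, the universal unital $C^*$-algebra generated by $C(\Omega)$ and a unitary representation of $\Gamma$, written $\gamma\mapsto\gamma$, with $\alpha(\gamma)f=\gamma f\gamma^*$. For $w\in\Gamma$ let $p_w\in C(\Omega)$ be the characteristic function of the set of infinite words beginning with $w$; for $u,v\in\Gamma\setminus\{1\}$ with $t(u)=t(v)$ let $s_{u,v}=uv^{-1}p_v\in C(\Omega)\rtimes\Gamma$; and let $\mathcal A$ be the $C^*$-subalgebra of $C(\Omega)\rtimes\Gamma$ generated by all these $s_{u,v}$. For $x\in S$ put $$r_x=\sum_{y\in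 S,\ |xy|=2}s_{xy,y}.$$ Let $M$ be the following matrix, whose rows and columns are indexed by $S$ in the order $a,a^{-1},b,b^{-1}$: $$M=\begin{pmatrix}1&0&1&1\\0&1&1&1\\1&1&1&0\\1&1&0&1\end{pmatrix}.$$ Let $\mathcal O_M$ be the Cuntz–Krieger algebra of $M$, that is, the universal unital $C^*$-algebra generated by partial isometries $S_x$ $(x\in S)$ with $\sum_x S_xS_x^*=1$ and $S_x^*S_x=\sum_y M(x,y)S_yS_y^*$. Then: 1. the $r_x$ are partial isometries with $\sum_{x\in S}r_xr_x^*=1$ and $r_x^*r_x=\sum_{y\in S}M(x,y)\,r_yr_y^*$ for all $x\in S$; 2. $\mathcal A=C(\Omega)\rtimes\Gamma$; 3. $C(\Omega)\rtimes\Gamma$ is generated as a unital $C^*$-algebra by $\{r_x : x\in S\}$; 4. there is a $*$-isomorphism $\mathcal O_M\to C(\Omega)\rtimes\Gamma$ that maps $S_x$ to $r_x$ for every $x\in S$. -/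

import Mathlib

open scoped ENNReal

noncomputable section

/-! ### Bounded products of unital C*-algebras -/

section BoundedProduct

variable {I : Type*} {B : I → Type*} [∀ i, CStarAlgebra (B i)]

/-- The bounded product `∏ᵢ Bᵢ` (bounded families, supremum norm) of nonzero unital C*-algebras. -/
instance boundedProductCStarAlgebra [∀ i, Nontrivial (B i)] : CStarAlgebra (lp B ∞) where

/-- The closed unital *-subalgebra of a C*-algebra `A` generated by a set `S`, that is, the
C*-subalgebra of `A` generated by `S` and the unit. -/
def cstarGenerate {A : Type*} [CStarAlgebra A] (S : Set A) : StarSubalgebra ℂ A :=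
  (StarAlgebra.adjoin ℂ S).topologicalClosure

theorem cstarGenerate_isClosed {A : Type*} [CStarAlgebra A] (S : Set A) :
    IsClosed (cstarGenerate S : Set A) :=
  (StarAlgebra.adjoin ℂ S).isClosed_topologicalClosure

theorem subset_cstarGenerate {A : Type*} [CStarAlgebra A] (S : Set A) :
    S ⊆ cstarGenerate S :=
  (StarAlgebra.subset_adjoin ℂ S).trans
    (StarAlgebra.adjoin ℂ S).le_topologicalClosure

theorem memℓp_starAlgHom {A : Type*} [CStarAlgebra A] (ρ : ∀ i, A →⋆ₐ[ℂ] B i) (f : A) :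
    Memℓp (fun i => ρ i f) ∞ :=
  memℓp_infty ⟨‖f‖, by rintro _ ⟨i, rfl⟩; exact NonUnitalStarAlgHom.norm_apply_le (ρ i) f⟩

/-- A family of unital *-homomorphisms `A → Bᵢ`, as one unital *-homomorphism `A → ∏ᵢ Bᵢ`. -/
def starAlgHomToBoundedProduct [∀ i, Nontrivial (B i)] {A : Type*} [CStarAlgebra A] (ρ : ∀ i, A →⋆ₐ[ℂ] B i) :
    A →⋆ₐ[ℂ] lp B ∞ where
  toFun f := ⟨fun i => ρ i f, memℓp_starAlgHom ρ f⟩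
  map_one' := by ext i; exact map_one (ρ i)
  map_mul' f g := by ext i; exact map_mul (ρ i) f g
  map_zero' := by ext i; exact map_zero (ρ i)
  map_add' f g := by ext i; exact map_add (ρ i) f g
  commutes' c := by ext i; exact AlgHomClass.commutes (ρ i) c
  map_star' f := by ext i; exact map_star (ρ i) f

theorem memℓp_unitary [∀ i, Nontrivial (B i)] (u : ∀ i, unitary (B i)) : Memℓp (fun i => (u i : B i)) ∞ :=
  memℓp_infty ⟨1, by rintro _ ⟨i, rfl⟩; exact (CStarRing.norm_coe_unitary (u i)).le⟩

theorem memℓp_of_partialIsometry (s : ∀ i, B i) (hs : ∀ i, s i * star (s i) * s i = s i) :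
    Memℓp s ∞ := by
  refine memℓp_infty ⟨1, ?_⟩
  rintro _ ⟨i, rfl⟩
  have hp : IsStarProjection (star (s i) * s i) :=
    ⟨by rw [IsIdempotentElem, mul_assoc, ← mul_assoc (s i), hs i], .star_mul_self _⟩
  have h1 : ‖s i‖ * ‖s i‖ ≤ 1 := by
    rw [← CStarRing.norm_star_mul_self]; exact hp.norm_le
  show ‖s i‖ ≤ 1
  nlinarith [norm_nonneg (s i)]

end BoundedProduct

/-! ### The crossed product of a compact space by a discrete group -/

section CrossedProduct

variable (Γ X : Type) [Group Γ] [TopologicalSpace X] [CompactSpace X] [MulAction Γ X]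
  [ContinuousConstSMul Γ X]

variable {Γ X} in
/-- The action `α` of `Γ` on `C(X)`: `α(γ) f (x) = f (γ⁻¹ x)`. -/
def translateFun (γ : Γ) (f : C(X, ℂ)) : C(X, ℂ) :=
  ⟨fun x => f (γ⁻¹ • x), f.continuous.comp (continuous_const_smul γ⁻¹)⟩

/-- A covariant representation of `(C(X), Γ, α)` in a nonzero unital C*-algebra: a unital
*-homomorphism `ρ` on `C(X)` and a unitary representation `π` of `Γ`
with `ρ(α(γ) f) = π(γ) ρ(f) π(γ)*`. -/
structure CovariantRep : Type 1 where
  carrier : Type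
  [cstar : CStarAlgebra carrier]
  [nontrivial : Nontrivial carrier]
  ρ : C(X, ℂ) →⋆ₐ[ℂ] carrier
  π : Γ →* unitary carrier
  covariant : ∀ (γ : Γ) (f : C(X, ℂ)),
    ρ (translateFun γ f) = (π γ : carrier) * ρ f * star (π γ : carrier)

attribute [instance] CovariantRep.cstar CovariantRep.nontrivial

/-- The bounded product of the targets of all covariant representations. -/
abbrev CovariantProduct : Type 1 := lp (fun R : CovariantRep Γ X => R.carrier) ∞

/-- The copy of `C(X)` in the product of all covariant representations. -/
def covariantFun : C(X, ℂ) →⋆ₐ[ℂ] CovariantProduct Γ X :=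
  starAlgHomToBoundedProduct fun R : CovariantRep Γ X => R.ρ

/-- The copy of `Γ` in the product of all covariant representations. -/
def covariantGroup (γ : Γ) : CovariantProduct Γ X :=
  ⟨fun R => (R.π γ : R.carrier), memℓp_unitary fun R : CovariantRep Γ X => R.π γ⟩

/-- The (full) crossed product `C(X) ⋊ Γ`: the universal C*-algebra generated by `C(X)` and a
unitary representation of `Γ` subject to the covariance relation, realized as the
C*-subalgebra generated by `C(X)` and `Γ` in the product of all covariant representations.
Since the C*-algebra generated by a covariant pair in a C*-algebra of any universe has an
isomorphic copy in `Type`, no representation is lost. -/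
def CrossedProduct : Type 1 :=
  cstarGenerate (Set.range (covariantFun Γ X) ∪ Set.range (covariantGroup Γ X))

instance : CStarAlgebra (CrossedProduct Γ X) :=
  StarSubalgebra.cstarAlgebra
    (cstarGenerate (Set.range (covariantFun Γ X) ∪ Set.range (covariantGroup Γ X)))
    (h_closed := cstarGenerate_isClosed _)

namespace CrossedProduct

variable {Γ X}

/-- The canonical *-homomorphism `C(X) → C(X) ⋊ Γ`. -/
def ofFun : C(X, ℂ) →⋆ₐ[ℂ] CrossedProduct Γ X :=
  (covariantFun Γ X).codRestrict
    (cstarGenerate (Set.range (covariantFun Γ X) ∪ Set.range (covariantGroup Γ X)))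
    fun f => subset_cstarGenerate _ (Or.inl ⟨f, rfl⟩)

/-- The canonical unitary of `C(X) ⋊ Γ` given by an element of `Γ`. -/
def ofGroup (γ : Γ) : CrossedProduct Γ X :=
  ⟨covariantGroup Γ X γ, subset_cstarGenerate _ (Or.inr ⟨γ, rfl⟩)⟩

end CrossedProduct

end CrossedProduct

/-! ### Cuntz–Krieger algebras -/

section CuntzKrieger

variable {n : Type} [Fintype n]

/-- Partial isometries `sᵢ` in a unital C*-algebra satisfying the Cuntz–Krieger relations
`∑ᵢ sᵢ sᵢ* = 1` and `sᵢ* sᵢ = ∑ⱼ M(i,j) sⱼ sⱼ*` of a matrix `M` with entries in `{0, 1}`. -/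
structure IsCuntzKriegerFamily (M : Matrix n n ℕ) {B : Type*} [CStarAlgebra B]
    (s : n → B) : Prop where
  partialIsometry : ∀ i, s i * star (s i) * s i = s i
  sum_range : ∑ i, s i * star (s i) = 1
  source : ∀ i, star (s i) * s i = ∑ j, (M i j : ℂ) • (s j * star (s j))

/-- A Cuntz–Krieger family for `M` in a nonzero unital C*-algebra. -/
structure CuntzKriegerRep (M : Matrix n n ℕ) : Type 1 where
  carrier : Type
  [cstar : CStarAlgebra carrier]
  [nontrivial : Nontrivial carrier]
  s : n → carrier
  isFamily : IsCuntzKriegerFamily M s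

attribute [instance] CuntzKriegerRep.cstar CuntzKriegerRep.nontrivial

/-- The family of generators in the product of all Cuntz–Krieger families for `M`. -/
def cuntzKriegerGen (M : Matrix n n ℕ) (i : n) :
    lp (fun R : CuntzKriegerRep M => R.carrier) ∞ :=
  ⟨fun R => R.s i, memℓp_of_partialIsometry _ fun R => R.isFamily.partialIsometry i⟩

/-- The Cuntz–Krieger algebra `𝒪_M`: the universal C*-algebra generated by partial isometries
satisfying the Cuntz–Krieger relations of `M`, realized as the C*-subalgebra
generated by the canonical family in the product of all Cuntz–Krieger families for `M`. -/
def CuntzKriegerAlgebra (M : Matrix n n ℕ) : Type 1 :=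
  cstarGenerate (Set.range (cuntzKriegerGen M))

instance (M : Matrix n n ℕ) : CStarAlgebra (CuntzKriegerAlgebra M) :=
  StarSubalgebra.cstarAlgebra (cstarGenerate (Set.range (cuntzKriegerGen M)))
    (h_closed := cstarGenerate_isClosed _)

/-- The canonical generators of `𝒪_M`. -/
def CuntzKriegerAlgebra.gen (M : Matrix n n ℕ) (i : n) : CuntzKriegerAlgebra M :=
  ⟨cuntzKriegerGen M i, subset_cstarGenerate _ ⟨i, rfl⟩⟩

end CuntzKrieger

/-! ### The free group of rank two acting on the boundary of its tree -/

namespace FreeBoundary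

/-- The letters `S = {a, a⁻¹, b, b⁻¹}`: `(0, true)` is `a`, `(0, false)` is `a⁻¹`,
`(1, true)` is `b` and `(1, false)` is `b⁻¹`, as in Mathlib's words of `FreeGroup (Fin 2)`. -/
abbrev Letter : Type := Fin 2 × Bool

/-- The free group `Γ` on two generators. -/
abbrev Gam : Type := FreeGroup (Fin 2)

/-- The inverse letter. -/
def inv (x : Letter) : Letter := (x.1, !x.2)

theorem inv_inv (x : Letter) : inv (inv x) = x := by simp [inv]

theorem inv_ne (x : Letter) : inv x ≠ x := by
  intro h; simpa [inv] using congrArg Prod.snd h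

/-- The element of `Γ` given by a letter. -/
def elt (x : Letter) : Gam := FreeGroup.mk [x]

/-- The boundary `Ω` of the tree: the infinite reduced words `x₀ x₁ x₂ …` in the letters, with
the topology of agreement on finite initial segments (the subspace topology of the product of
discrete spaces). -/
abbrev Boundary : Type := {ω : ℕ → Letter // ∀ n, ω (n + 1) ≠ inv (ω n)}

instance : CompactSpace Boundary := by
  have h : {ω : ℕ → Letter | ∀ n, ω (n + 1) ≠ inv (ω n)} =
      ⋂ n, (fun ω : ℕ → Letter => (ω (n + 1), ω n)) ⁻¹' {p | p.1 ≠ inv p.2} := by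
    ext ω; simp
  have hc : IsClosed {ω : ℕ → Letter | ∀ n, ω (n + 1) ≠ inv (ω n)} := by
    rw [h]
    exact isClosed_iInter fun n => (isClosed_discrete _).preimage (by fun_prop)
  exact isCompact_iff_compactSpace.mp hc.isCompact

/-- Left multiplication of an infinite reduced word by a letter: cancel if the word begins with
the inverse letter, and prepend the letter otherwise. -/
def letterMul (x : Letter) (ω : Boundary) : Boundary :=
  if h : ω.1 0 = inv x then ⟨fun n => ω.1 (n + 1), fun n => ω.2 (n + 1)⟩
  else ⟨fun n => Nat.casesOn n x ω.1, fun n => by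
    cases n with
    | zero => exact h
    | succ k => exact ω.2 k⟩

theorem letterMul_inv (x : Letter) (ω : Boundary) : letterMul x (letterMul (inv x) ω) = ω := by
  by_cases h : ω.1 0 = x
  · have h1 : ω.1 1 ≠ inv x := h ▸ ω.2 0
    apply Subtype.ext
    funext n
    cases n <;> simp [letterMul, inv_inv, h, h1]
  · apply Subtype.ext
    funext n
    simp [letterMul, inv_inv, h]

theorem continuous_coord (n : ℕ) : Continuous fun ω : Boundary => ω.1 n :=
  (continuous_apply n).comp continuous_subtype_val

theorem continuous_letterMul (x : Letter) : Continuous (letterMul x) := by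
  refine Continuous.subtype_mk (f := fun ω : Boundary => (letterMul x ω).1) ?_
    fun ω => (letterMul x ω).2
  refine continuous_pi fun n => ?_
  have : (fun ω : Boundary => (letterMul x ω).1 n) =
      (fun p : Letter × Letter × Letter =>
        if p.1 = inv x then p.2.1 else Nat.casesOn n x fun _ => p.2.2) ∘
      fun ω : Boundary => (ω.1 0, ω.1 (n + 1), ω.1 (n - 1)) := by
    funext ω
    by_cases h : ω.1 0 = inv x <;> cases n <;> simp [letterMul, h]
  rw [this]
  exact continuous_of_discreteTopology.comp
    ((continuous_coord _).prodMk ((continuous_coord _).prodMk (continuous_coord _)))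

/-- Left multiplication by a generator, as a homeomorphism of `Ω`. -/
def generatorHomeo (i : Fin 2) : Boundary ≃ₜ Boundary where
  toFun := letterMul (i, true)
  invFun := letterMul (i, false)
  left_inv := letterMul_inv (i, false)
  right_inv := letterMul_inv (i, true)
  continuous_toFun := continuous_letterMul _
  continuous_invFun := continuous_letterMul _

/-- The action of `Γ` on `Ω` by left multiplication. -/
instance : MulAction Gam Boundary where
  smul g ω := FreeGroup.lift generatorHomeo g ω
  one_smul ω := by
    show FreeGroup.lift generatorHomeo 1 ω = ω
    rw [map_one]; rfl
  mul_smul g h ω := by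
    show FreeGroup.lift generatorHomeo (g * h) ω =
      FreeGroup.lift generatorHomeo g (FreeGroup.lift generatorHomeo h ω)
    rw [map_mul]; rfl

instance : ContinuousConstSMul Gam Boundary where
  continuous_const_smul g := (FreeGroup.lift generatorHomeo g).continuous

/-- The set `Ω(w)` of infinite reduced words beginning with the reduced word of `w`. -/
def cylinder (w : Gam) : Set Boundary :=
  {ω | ∀ i : Fin w.toWord.length, ω.1 i = w.toWord.get i}

theorem isClopen_cylinder (w : Gam) : IsClopen (cylinder w) := by
  have : cylinder w = ⋂ i : Fin w.toWord.length,
      (fun ω : Boundary => ω.1 i) ⁻¹' {w.toWord.get i} := by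
    ext ω; simp [cylinder]
  rw [this]
  exact isClopen_iInter_of_finite fun i => (isClopen_discrete _).preimage (continuous_coord _)

/-- The characteristic function `p_w ∈ C(Ω)` of `Ω(w)`. -/
def p (w : Gam) : C(Boundary, ℂ) := LocallyConstant.charFn ℂ (isClopen_cylinder w)

/-- The crossed product `C(Ω) ⋊ Γ`. -/
abbrev Alg : Type 1 := CrossedProduct Gam Boundary

/-- The element `s_{u,v} = (u v⁻¹) p_v` of `C(Ω) ⋊ Γ` (used when `t(u) = t(v)`). -/
def s (u v : Gam) : Alg :=
  CrossedProduct.ofGroup (u * v⁻¹) * CrossedProduct.ofFun (p v)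

/-- `u` and `v` are nontrivial and their reduced words have the same final letter:
`t(u) = t(v)`. -/
def SameFinalLetter (u v : Gam) : Prop :=
  u ≠ 1 ∧ v ≠ 1 ∧ u.toWord.getLast? = v.toWord.getLast?

/-- `r_x`: the sum of `s_{xy,y}` over the letters `y` for which `xy` is reduced of length two. -/
def r (x : Letter) : Alg :=
  ∑ y : Letter with (elt x * elt y).norm = 2, s (elt x * elt y) (elt y)

/-- The letters in the order `a, a⁻¹, b, b⁻¹`. -/
def letter : Fin 4 → Letter := ![(0, true), (0, false), (1, true), (1, false)]

/-- The transition matrix, with respect to the order `a, a⁻¹, b, b⁻¹` of the letters. -/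
def M : Matrix (Fin 4) (Fin 4) ℕ :=
  !![1, 0, 1, 1;
     0, 1, 1, 1;
     1, 1, 1, 0;
     1, 1, 0, 1]

end FreeBoundary

end

noncomputable section

/-! ### Generators of C*-algebras -/

section Generators

variable {A C : Type*} [CStarAlgebra A] [CStarAlgebra C]

/-! Summing over `y ≠ x⁻¹` gives r_x = x(1 - p_{x⁻¹}). Since x carries the words that do not begin
with x⁻¹ onto those that begin with x, r_x is a partial isometry with range p_x and source 1 -
p_{x⁻¹}. As M(x,y) vanishes only at y = x⁻¹, these are the Cuntz–Krieger relations of M. The group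
is recovered by x = r_x + r_{x⁻¹}^* (`ofGroup_elt`), and the translates of the p_x then give every
coordinate function on Ω, so the r_x generate; they are sums of elements s_{u,v}.

For the isomorphism, every Cuntz–Krieger family S must yield a covariant representation. The
elements U_x = S_x + S_{x⁻¹}^* are unitaries with U_{x⁻¹} = U_x^*, hence represent the free group.
With σ(b) = ∑_y S_y b S_y^*, the elements E_{n,x} = σⁿ(S_x S_x^*) are commuting projections with ∑_x
E_{n,x} = 1 and E_{n,x} E_{n+1,x⁻¹} = 0. A character of the commutative C*-algebra they generate
therefore picks one letter for each n, that is, a point of Ω, and Gelfand duality gives a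
homomorphism from C(Ω) (`exists_starAlgHom_coordFun`). Covariance reduces to letters and coordinate
functions, where both sides satisfy the same explicit formula.

This representation sends r_x to U_x(1 - E_{0,x⁻¹}) = S_x. So both universal properties apply, and
the resulting homomorphisms are inverse to each other on generators. -/

theorem continuous_starAlgHom (f : C →⋆ₐ[ℂ] A) : Continuous f :=
  AddMonoidHomClass.continuous_of_bound f 1 fun c => by
    simpa using NonUnitalStarAlgHom.norm_apply_le f c

theorem cstarGenerate_le {T : Set A} {K : StarSubalgebra ℂ A} (hK : IsClosed (K : Set A))
    (h : T ⊆ K) : cstarGenerate T ≤ K :=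
  StarSubalgebra.topologicalClosure_minimal (StarAlgebra.adjoin_le h) hK

/-- If the image of `C` under an isometric embedding is generated by the image of `T`,
then `C` is generated by `T`. -/
theorem cstarGenerate_eq_top_of_isometry (ι : C →⋆ₐ[ℂ] A) (hι : Isometry ι) (T : Set C)
    (h : ∀ c, ι c ∈ cstarGenerate (ι '' T)) : cstarGenerate T = ⊤ := by
  refine eq_top_iff.mpr fun c _ => ?_
  have hc : ι c ∈ closure (ι '' (StarAlgebra.adjoin ℂ T : Set C)) := by
    have := h c
    rwa [cstarGenerate, ← StarAlgHom.map_adjoin] at this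
  show c ∈ closure (StarAlgebra.adjoin ℂ T : Set C)
  rwa [hι.isEmbedding.isInducing.closure_eq_preimage_closure_image]

theorem starAlgHom_mem_of_cstarGenerate_eq_top {T : Set C} (hT : cstarGenerate T = ⊤)
    (f : C →⋆ₐ[ℂ] A) {K : StarSubalgebra ℂ A} (hK : IsClosed (K : Set A))
    (h : ∀ t ∈ T, f t ∈ K) (c : C) : f c ∈ K := by
  have hle : cstarGenerate T ≤ K.comap f :=
    cstarGenerate_le (hK.preimage (continuous_starAlgHom f)) h
  exact hle (hT ▸ StarSubalgebra.mem_top)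

theorem starAlgHom_ext_of_cstarGenerate_eq_top {T : Set C} (hT : cstarGenerate T = ⊤)
    (f g : C →⋆ₐ[ℂ] A) (h : ∀ t ∈ T, f t = g t) : f = g := by
  have hle : cstarGenerate T ≤ StarAlgHom.equalizer f g :=
    cstarGenerate_le (isClosed_eq (continuous_starAlgHom f) (continuous_starAlgHom g)) h
  exact StarAlgHom.ext fun c => hle (hT ▸ StarSubalgebra.mem_top)

end Generators

/-! ### Coordinates of a bounded product -/

/-- The evaluation of a bounded product at an index. -/
def boundedProductEval {I : Type*} {B : I → Type*} [∀ i, CStarAlgebra (B i)]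
    [∀ i, Nontrivial (B i)] (i : I) : lp B ∞ →⋆ₐ[ℂ] B i where
  toFun f := f i
  map_one' := rfl
  map_mul' _ _ := rfl
  map_zero' := rfl
  map_add' _ _ := rfl
  commutes' _ := rfl
  map_star' _ := rfl

/-! ### Generators and relations of the crossed product -/

namespace CrossedProduct

variable {Γ X : Type} [Group Γ] [TopologicalSpace X] [CompactSpace X] [MulAction Γ X]
  [ContinuousConstSMul Γ X]

variable (Γ X) in
/-- The inclusion of the crossed product into the product of all covariant representations. -/
def toProduct : CrossedProduct Γ X →⋆ₐ[ℂ] CovariantProduct Γ X :=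
  StarSubalgebra.subtype
    (cstarGenerate (Set.range (covariantFun Γ X) ∪ Set.range (covariantGroup Γ X)))

theorem isometry_toProduct : Isometry (toProduct Γ X) := isometry_subtype_coe

theorem cstarGenerate_range_ofFun_union_range_ofGroup :
    cstarGenerate (Set.range (ofFun : C(X, ℂ) → CrossedProduct Γ X) ∪
      Set.range (ofGroup : Γ → CrossedProduct Γ X)) = ⊤ := by
  refine cstarGenerate_eq_top_of_isometry (toProduct Γ X) isometry_toProduct _ fun c => ?_
  rw [Set.image_union, ← Set.range_comp, ← Set.range_comp]
  exact c.2

/-- The homomorphism of the crossed product given by a covariant representation. -/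
def toRep (R : CovariantRep Γ X) : CrossedProduct Γ X →⋆ₐ[ℂ] R.carrier :=
  (boundedProductEval R).comp (toProduct Γ X)

@[simp] theorem toRep_ofFun (R : CovariantRep Γ X) (f : C(X, ℂ)) : toRep R (ofFun f) = R.ρ f := rfl

@[simp] theorem toRep_ofGroup (R : CovariantRep Γ X) (γ : Γ) :
    toRep R (ofGroup γ) = (R.π γ : R.carrier) := rfl

/-- The crossed product sits inside the product of all covariant representations, so identities may
be checked in each of them. -/
theorem ext_toRep {a b : CrossedProduct Γ X}
    (h : ∀ R : CovariantRep Γ X, toRep R a = toRep R b) : a = b :=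
  isometry_toProduct.injective (by ext R; exact h R)

theorem ofGroup_one : (ofGroup 1 : CrossedProduct Γ X) = 1 :=
  ext_toRep fun R => by simp

theorem ofGroup_mul (γ δ : Γ) :
    (ofGroup (γ * δ) : CrossedProduct Γ X) = ofGroup γ * ofGroup δ :=
  ext_toRep fun R => by simp

theorem star_ofGroup (γ : Γ) : star (ofGroup γ : CrossedProduct Γ X) = ofGroup γ⁻¹ :=
  ext_toRep fun R => by
    rw [map_star, toRep_ofGroup, toRep_ofGroup, map_inv]; rfl

theorem ofFun_translateFun (γ : Γ) (f : C(X, ℂ)) :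
    (ofFun (translateFun γ f) : CrossedProduct Γ X) =
      ofGroup γ * ofFun f * star (ofGroup γ) :=
  ext_toRep fun R => by simp [map_star, R.covariant]

theorem star_ofGroup_mul_self (γ : Γ) :
    star (ofGroup γ : CrossedProduct Γ X) * ofGroup γ = 1 := by
  rw [star_ofGroup, ← ofGroup_mul, inv_mul_cancel, ofGroup_one]

end CrossedProduct

/-! ### Generators and representations of the Cuntz–Krieger algebra -/

section CuntzKriegerAlgebra

variable {n : Type} [Fintype n]

theorem IsCuntzKriegerFamily.map {M : Matrix n n ℕ} {A B : Type*} [CStarAlgebra A]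
    [CStarAlgebra B] {s : n → A} (hs : IsCuntzKriegerFamily M s) (f : A →⋆ₐ[ℂ] B) :
    IsCuntzKriegerFamily M fun i => f (s i) where
  partialIsometry i := by rw [← map_star, ← map_mul, ← map_mul, hs.partialIsometry]
  sum_range := by simp_rw [← map_star, ← map_mul, ← map_sum, hs.sum_range, map_one]
  source i := by
    simp_rw [← map_star, ← map_mul, hs.source, map_sum, map_smul]

namespace CuntzKriegerAlgebra

variable (M : Matrix n n ℕ)

/-- The inclusion of the Cuntz–Krieger algebra into the product of all Cuntz–Krieger families. -/
def toProduct : CuntzKriegerAlgebra M →⋆ₐ[ℂ] lp (fun R : CuntzKriegerRep M => R.carrier) ∞ :=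
  StarSubalgebra.subtype (cstarGenerate (Set.range (cuntzKriegerGen M)))

theorem isometry_toProduct : Isometry (toProduct M) := isometry_subtype_coe

theorem cstarGenerate_range_gen : cstarGenerate (Set.range (gen M)) = ⊤ := by
  refine cstarGenerate_eq_top_of_isometry (toProduct M) (isometry_toProduct M) _ fun c => ?_
  rw [← Set.range_comp]
  exact c.2

variable {M}

/-- The homomorphism of the Cuntz–Krieger algebra given by a Cuntz–Krieger family. -/
def toRep (R : CuntzKriegerRep M) : CuntzKriegerAlgebra M →⋆ₐ[ℂ] R.carrier :=
  (boundedProductEval R).comp (toProduct M)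

@[simp] theorem toRep_gen (R : CuntzKriegerRep M) (i : n) : toRep R (gen M i) = R.s i := rfl

end CuntzKriegerAlgebra

end CuntzKriegerAlgebra

namespace FreeBoundary

/-! ### Coordinate functions on the boundary -/

theorem elt_smul (x : Letter) (ω : Boundary) : elt x • ω = letterMul x ω := by
  show FreeGroup.lift generatorHomeo (FreeGroup.mk [x]) ω = _
  rcases x with ⟨i, _ | _⟩ <;> simp [FreeGroup.lift_mk] <;> rfl

theorem elt_inv (x : Letter) : (elt x)⁻¹ = elt (inv x) := by
  simp [elt, inv, FreeGroup.inv_mk, FreeGroup.invRev]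

theorem letterMul_coord_zero (x : Letter) (ω : Boundary) :
    (letterMul (inv x) ω).1 0 = if ω.1 0 = x then ω.1 1 else inv x := by
  by_cases h : ω.1 0 = x <;> simp [letterMul, inv_inv, h]

theorem letterMul_coord_succ (x : Letter) (ω : Boundary) (n : ℕ) :
    (letterMul (inv x) ω).1 (n + 1) = if ω.1 0 = x then ω.1 (n + 2) else ω.1 n := by
  by_cases h : ω.1 0 = x <;> simp [letterMul, inv_inv, h]

/-- The characteristic function of the words whose `n`-th letter is `x`. -/
def coordFun (n : ℕ) (x : Letter) : C(Boundary, ℂ) :=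
  ⟨fun ω => if ω.1 n = x then 1 else 0,
    (continuous_of_discreteTopology (f := fun y : Letter => if y = x then (1 : ℂ) else 0)).comp
      (continuous_coord n)⟩

theorem coordFun_apply (n : ℕ) (x : Letter) (ω : Boundary) :
    coordFun n x ω = if ω.1 n = x then 1 else 0 := rfl

theorem star_coordFun (n : ℕ) (x : Letter) : star (coordFun n x) = coordFun n x := by
  ext ω
  by_cases h : ω.1 n = x <;> simp [coordFun_apply, h]

theorem isIdempotentElem_coordFun (n : ℕ) (x : Letter) : IsIdempotentElem (coordFun n x) := by
  ext ω
  simp [coordFun_apply]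

theorem sum_coordFun (n : ℕ) : ∑ x, coordFun n x = 1 := by
  ext ω
  simp [ContinuousMap.sum_apply, coordFun_apply]

/-- The word x⁻¹ω arises by deleting the first letter of ω if that letter is x, and by prepending
x⁻¹ otherwise; the two summands are these two cases. -/
theorem translateFun_coordFun_zero (x z : Letter) :
    translateFun (elt x) (coordFun 0 z) =
      coordFun 0 x * coordFun 1 z + (1 - coordFun 0 x) * if z = inv x then 1 else 0 := by
  ext ω
  show coordFun 0 z ((elt x)⁻¹ • ω) = _
  by_cases h : ω.1 0 = x <;> by_cases hz : z = inv x <;>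
    simp [elt_inv, elt_smul, coordFun_apply, letterMul_coord_zero, h, hz, eq_comm (a := inv x)]

theorem translateFun_coordFun_succ (x z : Letter) (n : ℕ) :
    translateFun (elt x) (coordFun (n + 1) z) =
      coordFun 0 x * coordFun (n + 2) z + (1 - coordFun 0 x) * coordFun n z := by
  ext ω
  show coordFun (n + 1) z ((elt x)⁻¹ • ω) = _
  by_cases h : ω.1 0 = x <;>
    simp [elt_inv, elt_smul, coordFun_apply, letterMul_coord_succ, h]

theorem coordFun_zero_mul_translateFun (x z : Letter) (n : ℕ) :
    coordFun 0 x * translateFun (elt x) (coordFun n z) = coordFun 0 x * coordFun (n + 1) z := by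
  have h := (isIdempotentElem_coordFun 0 x).eq
  have h' : coordFun 0 x * (1 - coordFun 0 x) = 0 := by rw [mul_sub, mul_one, h, sub_self]
  cases n with
  | zero => rw [translateFun_coordFun_zero, mul_add, ← mul_assoc, h, ← mul_assoc, h', zero_mul,
      add_zero]
  | succ n => rw [translateFun_coordFun_succ, mul_add, ← mul_assoc, h, ← mul_assoc, h', zero_mul,
      add_zero]

/-- On the words beginning with x, translation by x deletes the first letter. By this recursion the
functions `coordFun 0 x` and the group produce all coordinate functions. -/
theorem coordFun_succ (n : ℕ) (z : Letter) :
    coordFun (n + 1) z = ∑ x, coordFun 0 x * translateFun (elt x) (coordFun n z) := by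
  simp_rw [coordFun_zero_mul_translateFun, ← Finset.sum_mul, sum_coordFun, one_mul]

theorem p_elt (x : Letter) : p (elt x) = coordFun 0 x := by
  classical
  ext ω
  have : (ω ∈ cylinder (elt x)) ↔ ω.1 0 = x := by
    constructor
    · intro h
      exact h ⟨0, by simp [elt]⟩
    · rintro rfl ⟨i, hi⟩
      obtain rfl : i = 0 := by simpa [elt] using hi
      simp [elt]
  show Set.indicator (cylinder (elt x)) 1 ω = _
  simp [Set.indicator_apply, this, coordFun_apply]

/-- `C(Ω)` is generated by the coordinate functions. -/
theorem cstarGenerate_range_coordFun :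
    cstarGenerate (Set.range fun q : ℕ × Letter => coordFun q.1 q.2) = ⊤ := by
  -- Stone–Weierstrass: distinct words differ in some coordinate.
  refine ContinuousMap.starSubalgebra_topologicalClosure_eq_top_of_separatesPoints _ ?_
  intro ω ω' hne
  obtain ⟨n, hn⟩ : ∃ n, ω.1 n ≠ ω'.1 n := by
    by_contra! h
    exact hne (Subtype.ext (funext h))
  exact ⟨coordFun n (ω.1 n), ⟨coordFun n (ω.1 n),
    StarAlgebra.subset_adjoin _ _ ⟨(n, ω.1 n), rfl⟩, rfl⟩, by simp [coordFun_apply, hn.symm]⟩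

/-- Translation of functions by an element of `Γ`, as a *-homomorphism. -/
def translateHom (γ : Gam) : C(Boundary, ℂ) →⋆ₐ[ℂ] C(Boundary, ℂ) :=
  ContinuousMap.compStarAlgHom' ℂ ℂ ⟨fun x => γ⁻¹ • x, continuous_const_smul γ⁻¹⟩

theorem translateHom_apply (γ : Gam) (f : C(Boundary, ℂ)) :
    translateHom γ f = translateFun γ f := rfl

theorem translateFun_mul (γ δ : Gam) (f : C(Boundary, ℂ)) :
    translateFun (γ * δ) f = translateFun γ (translateFun δ f) := by
  ext ω
  simp [translateFun, mul_smul]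

theorem translateFun_one (f : C(Boundary, ℂ)) : translateFun (1 : Gam) f = f := by
  ext ω
  simp [translateFun]

/-- Induction on elements of `Γ` as products of letters. -/
@[elab_as_elim]
theorem induction_letters {P : Gam → Prop} (one : P 1) (elt : ∀ x, P (elt x))
    (mul : ∀ γ δ, P γ → P δ → P (γ * δ)) (γ : Gam) : P γ := by
  induction γ using FreeGroup.induction_on with
  | C1 => exact one
  | of i => exact elt (i, true)
  | inv_of i _ =>
    rw [show (FreeGroup.of i)⁻¹ = FreeBoundary.elt (i, false) from elt_inv _]
    exact elt _
  | mul γ δ hγ hδ => exact mul γ δ hγ hδ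

/-- Covariance needs to be checked only on letters and coordinate functions. -/
theorem covariant_of_letters {B : Type*} [CStarAlgebra B] (ρ : C(Boundary, ℂ) →⋆ₐ[ℂ] B)
    (π : Gam →* unitary B)
    (h : ∀ x n z, ρ (translateFun (elt x) (coordFun n z)) =
      (π (elt x) : B) * ρ (coordFun n z) * star (π (elt x) : B))
    (γ : Gam) (f : C(Boundary, ℂ)) :
    ρ (translateFun γ f) = (π γ : B) * ρ f * star (π γ : B) := by
  induction γ using induction_letters generalizing f with
  | one => simp [translateFun_one]
  | elt x =>
    -- For fixed x both sides are *-homomorphisms in f, so agreement on generators of C(Ω) suffices.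
    have := starAlgHom_ext_of_cstarGenerate_eq_top cstarGenerate_range_coordFun
      (ρ.comp (translateHom (elt x)))
      ((Unitary.conjStarAlgAut ℂ B (π (elt x)) : B →⋆ₐ[ℂ] B).comp ρ)
      (by
        rintro _ ⟨⟨n, z⟩, rfl⟩
        simpa [translateHom_apply, Unitary.conjStarAlgAut_apply] using h x n z)
    simpa [translateHom_apply, Unitary.conjStarAlgAut_apply] using congr($this f)
  | mul γ δ hγ hδ =>
    rw [translateFun_mul, hγ, hδ]
    simp [mul_assoc]

/-! ### The elements `r_x` of the crossed product -/

open CrossedProduct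

theorem norm_elt_mul_elt (x y : Letter) : (elt x * elt y).norm = 2 ↔ y ≠ inv x := by
  rcases x with ⟨i, b⟩
  rcases y with ⟨j, c⟩
  simp only [elt, FreeGroup.mul_mk, FreeGroup.norm, FreeGroup.toWord_mk]
  revert i b j c
  decide

theorem sum_filter_ne_coordFun (x : Letter) :
    ∑ y : Letter with y ≠ x, coordFun 0 y = 1 - coordFun 0 x := by
  rw [eq_sub_iff_add_eq, ← sum_coordFun 0, Finset.filter_ne' _ x,
    Finset.sum_erase_add _ _ (Finset.mem_univ x)]

theorem r_eq (x : Letter) :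
    r x = ofGroup (elt x) * ofFun (1 - coordFun 0 (inv x)) := by
  rw [← sum_filter_ne_coordFun, map_sum, r]
  refine Eq.trans (Finset.sum_congr (by simp [norm_elt_mul_elt]) fun y _ => ?_)
    (Finset.mul_sum _ _ _).symm
  rw [s, mul_inv_cancel_right, p_elt]

theorem star_r (x : Letter) :
    star (r x) = ofFun (1 - coordFun 0 (inv x)) * star (ofGroup (elt x)) := by
  rw [r_eq, star_mul, ← map_star, star_sub, star_one, star_coordFun]

theorem isIdempotentElem_one_sub (x : Letter) :
    (1 - coordFun 0 x) * (1 - coordFun 0 x) = 1 - coordFun 0 x :=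
  (isIdempotentElem_coordFun 0 x).one_sub.eq

theorem translateFun_one_sub (x : Letter) :
    translateFun (elt x) (1 - coordFun 0 (inv x)) = coordFun 0 x := by
  ext ω
  show 1 - coordFun 0 (inv x) ((elt x)⁻¹ • ω) = _
  have h1 : ω.1 0 = x → ω.1 1 ≠ inv x := fun h => h ▸ ω.2 0
  by_cases h : ω.1 0 = x <;>
    simp [elt_inv, elt_smul, coordFun_apply, letterMul_coord_zero, h]
  exact h1 h

theorem r_mul_star_r (x : Letter) : r x * star (r x) = ofFun (coordFun 0 x) := by
  rw [star_r, r_eq, mul_assoc, ← mul_assoc (ofFun _) (ofFun _), ← map_mul,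
    isIdempotentElem_one_sub, ← mul_assoc, ← ofFun_translateFun, translateFun_one_sub]

theorem star_r_mul_r (x : Letter) : star (r x) * r x = ofFun (1 - coordFun 0 (inv x)) := by
  rw [star_r, r_eq, mul_assoc, ← mul_assoc (star _), star_ofGroup_mul_self, one_mul, ← map_mul,
    isIdempotentElem_one_sub]

/-- The Cuntz–Krieger relations of `M`, with the letters as indices. -/
structure IsLetterFamily {B : Type*} [CStarAlgebra B] (S : Letter → B) : Prop where
  partialIsometry : ∀ x, S x * star (S x) * S x = S x
  sum_range : ∑ x, S x * star (S x) = 1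
  source : ∀ x, star (S x) * S x = 1 - S (inv x) * star (S (inv x))

theorem isLetterFamily_r : IsLetterFamily r where
  partialIsometry x := by
    rw [mul_assoc, star_r_mul_r, r_eq, mul_assoc, ← map_mul, isIdempotentElem_one_sub]
  sum_range := by simp_rw [r_mul_star_r, ← map_sum, sum_coordFun, map_one]
  source x := by rw [star_r_mul_r, r_mul_star_r, map_sub, map_one]

/-- The enumeration of the letters, as an equivalence. -/
def letterEquiv : Fin 4 ≃ Letter := Equiv.ofBijective letter (by decide)

theorem M_apply (i j : Fin 4) : M i j = if letter j = inv (letter i) then 0 else 1 := by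
  fin_cases i <;> fin_cases j <;> rfl

/-- Each row of M has its only zero at the inverse letter; as the range projections sum to 1, the
source relation says that the source of S_x is the complement of the range of S_{x⁻¹}. -/
theorem isCuntzKriegerFamily_iff {B : Type*} [CStarAlgebra B] (S : Letter → B) :
    IsCuntzKriegerFamily M (fun i => S (letter i)) ↔ IsLetterFamily S := by
  have hsum (f : Letter → B) : ∑ i, f (letter i) = ∑ x, f x := letterEquiv.sum_comp f
  have hsurj : Function.Surjective letter := letterEquiv.surjective
  have hM (h : ∑ x, S x * star (S x) = 1) (i : Fin 4) :
      ∑ j, (M i j : ℂ) • (S (letter j) * star (S (letter j))) =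
        1 - S (inv (letter i)) * star (S (inv (letter i))) := by
    simp_rw [M_apply]
    rw [hsum fun y => ((if y = inv (letter i) then 0 else 1 : ℕ) : ℂ) • (S y * star (S y)),
      eq_sub_iff_add_eq, ← h, ← Finset.sum_erase_add _ _ (Finset.mem_univ (inv (letter i))),
      ← Finset.sum_erase_add Finset.univ (fun x => S x * star (S x))
        (Finset.mem_univ (inv (letter i)))]
    simp only [if_true, Nat.cast_zero, zero_smul, add_zero]
    congr 1
    refine Finset.sum_congr rfl fun y hy => ?_
    simp [Finset.ne_of_mem_erase hy]
  constructor
  · intro h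
    have h1 : ∑ x, S x * star (S x) = 1 := by
      rw [← hsum fun x => S x * star (S x)]; exact h.sum_range
    refine ⟨hsurj.forall.mpr h.partialIsometry, h1, hsurj.forall.mpr fun i => ?_⟩
    rw [h.source, hM h1]
  · intro h
    refine ⟨fun i => h.partialIsometry _, ?_, fun i => ?_⟩
    · rw [← h.sum_range, ← hsum fun x => S x * star (S x)]
    · rw [h.source, hM h.sum_range]

/-- Each letter is `r_x + r_{x⁻¹}^*` in the crossed product. -/
theorem ofGroup_elt (x : Letter) : (ofGroup (elt x) : Alg) = r x + star (r (inv x)) := by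
  have h : (ofFun (coordFun 0 x) : Alg) * ofGroup (elt x) =
      ofGroup (elt x) * ofFun (1 - coordFun 0 (inv x)) := by
    rw [← translateFun_one_sub x, ofFun_translateFun, mul_assoc, star_ofGroup_mul_self, mul_one]
  rw [star_r, inv_inv, ← elt_inv, star_ofGroup, _root_.inv_inv, map_sub, map_one, sub_mul, h,
    r_eq, one_mul, add_sub_cancel]

theorem cstarGenerate_range_r : cstarGenerate (Set.range r) = ⊤ := by
  set K := cstarGenerate (Set.range r) with hKdef
  have hK : IsClosed (K : Set Alg) := cstarGenerate_isClosed _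
  have hr (x : Letter) : r x ∈ K := subset_cstarGenerate _ ⟨x, rfl⟩
  have hgroup (γ : Gam) : (ofGroup γ : Alg) ∈ K := by
    induction γ using induction_letters with
    | one => rw [ofGroup_one]; exact one_mem K
    | elt x => rw [ofGroup_elt]; exact add_mem (hr x) (star_mem (hr _))
    | mul γ δ hγ hδ => rw [ofGroup_mul]; exact mul_mem hγ hδ
  have hzero (x : Letter) : (ofFun (coordFun 0 x) : Alg) ∈ K := by
    rw [← r_mul_star_r]; exact mul_mem (hr x) (star_mem (hr x))
  have hcoord (n : ℕ) (z : Letter) : (ofFun (coordFun n z) : Alg) ∈ K := by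
    induction n with
    | zero => exact hzero z
    | succ n ih =>
      rw [coordFun_succ, map_sum]
      refine sum_mem fun x _ => ?_
      rw [map_mul, ofFun_translateFun]
      exact mul_mem (hzero x) (mul_mem (mul_mem (hgroup _) ih) (star_mem (hgroup _)))
  rw [eq_top_iff, ← cstarGenerate_range_ofFun_union_range_ofGroup]
  refine cstarGenerate_le hK (Set.union_subset ?_ ?_)
  · rintro _ ⟨f, rfl⟩
    refine starAlgHom_mem_of_cstarGenerate_eq_top cstarGenerate_range_coordFun ofFun hK ?_ f
    rintro _ ⟨⟨n, z⟩, rfl⟩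
    exact hcoord n z
  · rintro _ ⟨γ, rfl⟩
    exact hgroup γ

theorem sameFinalLetter_of_norm {x y : Letter} (h : (elt x * elt y).norm = 2) :
    SameFinalLetter (elt x * elt y) (elt y) := by
  rw [norm_elt_mul_elt] at h
  revert h
  simp only [SameFinalLetter, ne_eq, ← FreeGroup.toWord_eq_nil_iff]
  rcases x with ⟨i, b⟩
  rcases y with ⟨j, c⟩
  simp only [elt, FreeGroup.mul_mk, FreeGroup.toWord_mk]
  revert i b j c
  decide

/-- Each r_x is a sum of admissible s_{u,v}. The unit that `cstarGenerate` adjoins costs nothing,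
since it equals ∑ r_x r_x^*. -/
theorem cstarGenerate_s :
    cstarGenerate {z : Alg | ∃ u v : Gam, SameFinalLetter u v ∧ z = s u v} = ⊤ := by
  rw [eq_top_iff, ← cstarGenerate_range_r]
  refine cstarGenerate_le (cstarGenerate_isClosed _) ?_
  rintro _ ⟨x, rfl⟩
  refine sum_mem fun y hy => subset_cstarGenerate _ ⟨_, _, ?_, rfl⟩
  exact sameFinalLetter_of_norm (Finset.mem_filter.mp hy).2

end FreeBoundary

/-- Projections in a C*-algebra that sum to the unit are mutually orthogonal. -/
theorem mul_eq_zero_of_sum_eq_one {ι B : Type*} [Fintype ι] [CStarAlgebra B] {P : ι → B}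
    (hP : ∀ i, IsStarProjection (P i)) (hsum : ∑ i, P i = 1) {i j : ι} (hij : i ≠ j) :
    P i * P j = 0 := by
  classical
  let := CStarAlgebra.spectralOrder B
  have := CStarAlgebra.spectralOrderedRing B
  have hterm (k : ι) : star (P k * P j) * (P k * P j) = P j * P k * P j := by
    rw [star_mul, (hP k).isSelfAdjoint.star_eq, (hP j).isSelfAdjoint.star_eq, mul_assoc,
      ← mul_assoc (P k), (hP k).isIdempotentElem.eq, mul_assoc]
  have htotal : ∑ k, P j * P k * P j = P j := by
    rw [← Finset.sum_mul, ← Finset.mul_sum, hsum, mul_one, (hP j).isIdempotentElem.eq]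
  -- In P_j = ∑_k P_j P_k P_j the term k = j is already P_j. The remaining terms are positive with
  -- sum zero, so each vanishes.
  have hzero : ∑ k ∈ Finset.univ.erase j, star (P k * P j) * (P k * P j) = 0 := by
    simp_rw [hterm]
    rw [← add_left_inj (P j * P j * P j), zero_add,
      Finset.sum_erase_add _ (fun k => P j * P k * P j) (Finset.mem_univ j), htotal,
      (hP j).isIdempotentElem.eq, (hP j).isIdempotentElem.eq]
  rw [Finset.sum_eq_zero_iff_of_nonneg fun k _ => star_mul_self_nonneg _] at hzero
  exact CStarRing.star_mul_self_eq_zero_iff _ |>.mp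
    (hzero i (Finset.mem_erase.mpr ⟨hij, Finset.mem_univ i⟩))

namespace FreeBoundary

/-! ### The commuting projections of a Cuntz–Krieger family -/

section LetterFamily

variable {B : Type*} [CStarAlgebra B]

/-- The range projection of a member of the family. -/
def rangeProj (S : Letter → B) (x : Letter) : B := S x * star (S x)

/-- The shift `b ↦ ∑_y S_y b S_y^*`. -/
def shift (S : Letter → B) (b : B) : B := ∑ y, S y * b * star (S y)

/-- The sum of the range projections of the words whose `n`-th letter is `x`. -/
def coordProj (S : Letter → B) : ℕ → Letter → B
  | 0, x => rangeProj S x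
  | n + 1, x => shift S (coordProj S n x)

/-- The unitary that represents a letter. -/
def letterUnitary (S : Letter → B) (x : Letter) : B := S x + star (S (inv x))

theorem star_letterUnitary (S : Letter → B) (x : Letter) :
    star (letterUnitary S x) = letterUnitary S (inv x) := by
  simp [letterUnitary, inv_inv, add_comm]

theorem star_shift (S : Letter → B) (b : B) : star (shift S b) = shift S (star b) := by
  simp [shift, mul_assoc]

theorem shift_zero (S : Letter → B) : shift S 0 = 0 := by simp [shift]

theorem shift_sum (S : Letter → B) (f : Letter → B) :
    shift S (∑ x, f x) = ∑ x, shift S (f x) := by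
  simp_rw [shift, Finset.mul_sum, Finset.sum_mul]
  exact Finset.sum_comm

namespace IsLetterFamily

variable {S : Letter → B} (h : IsLetterFamily S)
include h

theorem source_eq (x : Letter) : star (S x) * S x = 1 - rangeProj S (inv x) := h.source x

theorem mul_source (x : Letter) : S x * (star (S x) * S x) = S x := by
  rw [← mul_assoc, h.partialIsometry]

theorem source_mul_star (x : Letter) : star (S x) * S x * star (S x) = star (S x) := by
  simpa [mul_assoc] using congr(star $(h.partialIsometry x))

theorem isStarProjection_rangeProj (x : Letter) : IsStarProjection (rangeProj S x) :=
  ⟨by rw [IsIdempotentElem, rangeProj, ← mul_assoc, h.partialIsometry], .mul_star_self _⟩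

theorem star_mul_of_ne {x y : Letter} (hxy : x ≠ y) : star (S x) * S y = 0 := by
  have := mul_eq_zero_of_sum_eq_one h.isStarProjection_rangeProj h.sum_range hxy
  rw [← h.source_mul_star x, ← h.partialIsometry y]
  calc _ = star (S x) * (rangeProj S x * rangeProj S y) * S y := by simp only [rangeProj, mul_assoc]
    _ = 0 := by rw [this, mul_zero, zero_mul]

theorem rangeProj_mul (x : Letter) : rangeProj S x * S x = S x := h.partialIsometry x

theorem mul_rangeProj_inv (x : Letter) : S x * rangeProj S (inv x) = 0 := by
  have := h.mul_source x
  rwa [h.source_eq, mul_sub, mul_one, sub_eq_self] at this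

theorem star_mul_shift (z : Letter) (b : B) :
    star (S z) * shift S b = star (S z) * S z * b * star (S z) := by
  rw [shift, Finset.mul_sum, Finset.sum_eq_single z]
  · simp only [mul_assoc]
  · intro y _ hy
    rw [← mul_assoc, ← mul_assoc, h.star_mul_of_ne hy.symm, zero_mul, zero_mul]
  · simp

theorem shift_mul_self (z : Letter) (b : B) :
    shift S b * S z = S z * b * (star (S z) * S z) := by
  rw [shift, Finset.sum_mul, Finset.sum_eq_single z]
  · simp only [mul_assoc]
  · intro y _ hy
    rw [mul_assoc, h.star_mul_of_ne hy, mul_zero]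
  · simp

theorem rangeProj_mul_shift (z : Letter) (b : B) :
    rangeProj S z * shift S b = S z * b * star (S z) := by
  rw [rangeProj, mul_assoc, h.star_mul_shift, ← mul_assoc, ← mul_assoc, h.mul_source]

theorem shift_mul_rangeProj (z : Letter) (b : B) :
    shift S b * rangeProj S z = S z * b * star (S z) := by
  rw [rangeProj, ← mul_assoc, h.shift_mul_self, mul_assoc, h.source_mul_star]

theorem commute_rangeProj_shift (z : Letter) (b : B) : Commute (rangeProj S z) (shift S b) :=
  (h.rangeProj_mul_shift z b).trans (h.shift_mul_rangeProj z b).symm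

theorem commute_source {b : B} (hb : ∀ z, Commute (rangeProj S z) b) (x : Letter) :
    Commute (star (S x) * S x) b := by
  rw [h.source_eq]
  exact (Commute.one_left b).sub_left (hb _)

/-- Orthogonality of ranges leaves the terms S_y a (S_y^* S_y) b S_y^*. The source projection is 1
minus a range projection, so it moves past b and is absorbed by S_y^*. -/
theorem shift_mul_shift (a : B) {b : B} (hb : ∀ z, Commute (rangeProj S z) b) :
    shift S a * shift S b = shift S (a * b) := by
  rw [shift, Finset.sum_mul]
  refine Finset.sum_congr rfl fun y _ => ?_
  rw [mul_assoc, h.star_mul_shift, (h.commute_source hb y).eq, mul_assoc b, h.source_mul_star]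
  simp only [mul_assoc]

theorem shift_one : shift S 1 = 1 := by simpa [shift] using h.sum_range

theorem commute_rangeProj_rangeProj (x y : Letter) :
    Commute (rangeProj S x) (rangeProj S y) := by
  obtain rfl | hxy := eq_or_ne x y
  · exact Commute.refl _
  · have hz := fun {i j : Letter} (hij : i ≠ j) =>
      mul_eq_zero_of_sum_eq_one h.isStarProjection_rangeProj h.sum_range hij
    exact (hz hxy).trans (hz hxy.symm).symm

theorem commute_rangeProj_coordProj (x : Letter) (n : ℕ) (z : Letter) :
    Commute (rangeProj S x) (coordProj S n z) := by
  cases n with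
  | zero => exact h.commute_rangeProj_rangeProj x z
  | succ n => exact h.commute_rangeProj_shift x _

theorem star_coordProj (n : ℕ) (x : Letter) : star (coordProj S n x) = coordProj S n x := by
  induction n with
  | zero => exact (h.isStarProjection_rangeProj x).isSelfAdjoint
  | succ n ih => rw [coordProj, star_shift, ih]

theorem isIdempotentElem_coordProj (n : ℕ) (x : Letter) :
    IsIdempotentElem (coordProj S n x) := by
  induction n with
  | zero => exact (h.isStarProjection_rangeProj x).isIdempotentElem
  | succ n ih =>
    rw [IsIdempotentElem, coordProj,
      h.shift_mul_shift _ fun z => h.commute_rangeProj_coordProj z n x, ih.eq]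

theorem sum_coordProj (n : ℕ) : ∑ x, coordProj S n x = 1 := by
  induction n with
  | zero => exact h.sum_range
  | succ n ih => simp_rw [coordProj, ← shift_sum, ih, h.shift_one]

/-- For n = 0 this is S_x P_{x⁻¹} = 0, where P denotes the range projections; the shift,
multiplicative on these elements, carries it to all n. -/
theorem coordProj_mul_coordProj_inv (n : ℕ) (x : Letter) :
    coordProj S n x * coordProj S (n + 1) (inv x) = 0 := by
  induction n with
  | zero =>
    rw [coordProj, coordProj, h.rangeProj_mul_shift, coordProj, h.mul_rangeProj_inv, zero_mul]
  | succ n ih =>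
    rw [coordProj, coordProj,
      h.shift_mul_shift _ fun z => h.commute_rangeProj_coordProj z (n + 1) _, ih, shift_zero]

theorem commute_coordProj (n m : ℕ) (x y : Letter) :
    Commute (coordProj S n x) (coordProj S m y) := by
  induction n generalizing m with
  | zero => exact h.commute_rangeProj_coordProj x m y
  | succ n ih =>
    cases m with
    | zero => exact (h.commute_rangeProj_coordProj y (n + 1) x).symm
    | succ m =>
      rw [Commute, SemiconjBy, coordProj, coordProj,
        h.shift_mul_shift _ fun z => h.commute_rangeProj_coordProj z m y,
        h.shift_mul_shift _ fun z => h.commute_rangeProj_coordProj z n x, (ih m).eq]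

/-- The cross terms vanish: in S_x b S_{x⁻¹} the range projection of S_{x⁻¹} moves left past b and
is killed by S_x, and similarly for the other term. -/
theorem letterUnitary_conj {b : B} (hb : ∀ z, Commute (rangeProj S z) b) (x : Letter) :
    letterUnitary S x * b * star (letterUnitary S x) =
      S x * b * star (S x) + star (S (inv x)) * b * S (inv x) := by
  have h1 : S x * b * S (inv x) = 0 := by
    rw [← h.rangeProj_mul (inv x), ← mul_assoc, mul_assoc (S x), ← (hb (inv x)).eq, ← mul_assoc,
      h.mul_rangeProj_inv, zero_mul, zero_mul]
  have h2 : star (S (inv x)) * b * star (S x) = 0 := by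
    have h3 : rangeProj S (inv x) * star (S x) = 0 := by
      have := congr(star $(h.mul_rangeProj_inv x))
      rwa [star_mul, (h.isStarProjection_rangeProj _).isSelfAdjoint.star_eq, star_zero] at this
    have h4 : star (S (inv x)) = star (S (inv x)) * rangeProj S (inv x) := by
      rw [rangeProj, ← mul_assoc, h.source_mul_star]
    rw [h4, mul_assoc (star _), (hb (inv x)).eq, mul_assoc, mul_assoc, h3, mul_zero, mul_zero]
  simp only [letterUnitary, star_add, star_star, add_mul, mul_add, h1, h2, add_zero, zero_add]

theorem letterUnitary_mul_star (x : Letter) :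
    letterUnitary S x * star (letterUnitary S x) = 1 := by
  have := h.letterUnitary_conj (b := 1) (fun z => Commute.one_right _) x
  rw [mul_one] at this
  rw [this, mul_one, mul_one, h.source_eq, inv_inv, rangeProj, add_sub_cancel]

theorem star_mul_letterUnitary (x : Letter) :
    star (letterUnitary S x) * letterUnitary S x = 1 := by
  have := h.letterUnitary_mul_star (inv x)
  rwa [star_letterUnitary, inv_inv, ← star_letterUnitary] at this

/-- The right side has the form of `translateFun_coordFun_zero`, so covariance follows by
comparison; the next lemma plays the same role for later letters. -/
theorem letterUnitary_conj_coordProj_zero (x z : Letter) :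
    letterUnitary S x * coordProj S 0 z * star (letterUnitary S x) =
      coordProj S 0 x * coordProj S 1 z +
        (1 - coordProj S 0 x) * if z = inv x then 1 else 0 := by
  rw [h.letterUnitary_conj fun y => h.commute_rangeProj_coordProj y 0 z]
  congr 1
  · exact (h.rangeProj_mul_shift x _).symm
  · rw [coordProj, coordProj]
    split_ifs with hz
    · rw [hz, mul_assoc, h.rangeProj_mul, h.source_eq, inv_inv, mul_one]
    · rw [rangeProj, ← mul_assoc, h.star_mul_of_ne (Ne.symm hz), zero_mul, zero_mul, mul_zero]

theorem letterUnitary_conj_coordProj_succ (x z : Letter) (n : ℕ) :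
    letterUnitary S x * coordProj S (n + 1) z * star (letterUnitary S x) =
      coordProj S 0 x * coordProj S (n + 2) z + (1 - coordProj S 0 x) * coordProj S n z := by
  rw [h.letterUnitary_conj fun y => h.commute_rangeProj_coordProj y (n + 1) z]
  congr 1
  · exact (h.rangeProj_mul_shift x _).symm
  · have hc := h.commute_source (fun y => h.commute_rangeProj_coordProj y n z) (inv x)
    have hs : star (S (inv x)) * S (inv x) = 1 - coordProj S 0 x := by
      rw [h.source_eq, inv_inv, coordProj]
    show star (S (inv x)) * shift S (coordProj S n z) * S (inv x) = _
    rw [h.star_mul_shift, mul_assoc, hc.eq, mul_assoc, ← mul_assoc _ (star _),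
      h.source_mul_star, ← hc.eq, hs]

theorem letterUnitary_mul_one_sub (x : Letter) :
    letterUnitary S x * (1 - coordProj S 0 (inv x)) = S x := by
  have h1 : star (S (inv x)) * rangeProj S (inv x) = star (S (inv x)) := by
    rw [rangeProj, ← mul_assoc, h.source_mul_star]
  rw [coordProj, letterUnitary, mul_sub, mul_one, add_mul, h.mul_rangeProj_inv, h1, zero_add,
    add_sub_cancel_right]

end IsLetterFamily

end LetterFamily

/-! ### Representations of `C(Ω)` from commuting projections -/

/-- Projections with the relations of the coordinate functions, in a commutative C*-algebra. -/
theorem exists_starAlgHom_coordFun {D : Type*} [CommCStarAlgebra D] (E : ℕ → Letter → D)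
    (idem : ∀ n x, IsIdempotentElem (E n x)) (sum : ∀ n, ∑ x, E n x = 1)
    (reduced : ∀ n x, E n x * E (n + 1) (inv x) = 0) :
    ∃ ρ : C(Boundary, ℂ) →⋆ₐ[ℂ] D, ∀ n x, ρ (coordFun n x) = E n x := by
  classical
  have hval (χ : WeakDual.characterSpace ℂ D) (n : ℕ) (x : Letter) : χ (E n x) = 0 ∨ χ (E n x) = 1 :=
    IsIdempotentElem.iff_eq_zero_or_one.mp ((idem n x).map χ)
  have hsum (χ : WeakDual.characterSpace ℂ D) (n : ℕ) : ∑ x, χ (E n x) = 1 := by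
    rw [← map_sum, sum, map_one]
  have hex (χ : WeakDual.characterSpace ℂ D) (n : ℕ) :
      ∃ y, ∀ x, χ (E n x) = if y = x then 1 else 0 := by
    set T := Finset.univ.filter fun x => χ (E n x) = 1 with hT
    have hind (x : Letter) : χ (E n x) = if x ∈ T then 1 else 0 := by
      rcases hval χ n x with h | h <;> simp [hT, h]
    -- The values are 0 or 1 and sum to 1, so exactly one letter has value 1; it is the n-th letter
    -- of the word of χ.
    have hcard : T.card = 1 := by
      have := hsum χ n
      simp_rw [hind, Finset.sum_ite_mem, Finset.univ_inter, Finset.sum_const, nsmul_eq_mul,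
        mul_one] at this
      exact_mod_cast this
    obtain ⟨y, hy⟩ := Finset.card_eq_one.mp hcard
    exact ⟨y, fun x => by rw [hind, hy]; simp [eq_comm]⟩
  choose ω hω using hex
  have hred (χ : WeakDual.characterSpace ℂ D) (n : ℕ) : ω χ (n + 1) ≠ inv (ω χ n) := by
    intro heq
    have := congr(χ $(reduced n (ω χ n)))
    rw [map_mul, hω, hω, if_pos rfl, if_pos heq, map_zero, mul_one] at this
    exact one_ne_zero this
  have hcont : Continuous ω := by
    refine continuous_pi fun n => continuous_discrete_rng.mpr fun x => ?_
    -- The n-th letter is x exactly where the Gelfand transform of E_{n,x} is nonzero, an open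
    -- condition.
    have : (fun χ => ω χ n) ⁻¹' {x} = (fun χ => WeakDual.gelfandTransform ℂ D (E n x) χ) ⁻¹' {0}ᶜ := by
      ext χ
      simp [WeakDual.gelfandTransform_apply_apply, hω]
    rw [this]
    exact isOpen_compl_singleton.preimage (map_continuous _)
  let g : C(WeakDual.characterSpace ℂ D, Boundary) :=
    ⟨fun χ => ⟨ω χ, hred χ⟩, hcont.subtype_mk _⟩
  refine ⟨((gelfandStarTransform D).symm : C(WeakDual.characterSpace ℂ D, ℂ) →⋆ₐ[ℂ] D).comp
    (ContinuousMap.compStarAlgHom' ℂ ℂ g), fun n x => ?_⟩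
  show (gelfandStarTransform D).symm ((coordFun n x).comp g) = E n x
  rw [StarAlgEquiv.symm_apply_eq]
  ext χ
  show (if ω χ n = x then (1 : ℂ) else 0) = χ (E n x)
  rw [hω]

/-! ### The covariant representation of a Cuntz–Krieger family -/

namespace IsLetterFamily

theorem exists_starAlgHom {B : Type*} [CStarAlgebra B] {S : Letter → B} (h : IsLetterFamily S) :
    ∃ ρ : C(Boundary, ℂ) →⋆ₐ[ℂ] B, ∀ n x, ρ (coordFun n x) = coordProj S n x := by
  set T := Set.range fun q : ℕ × Letter => coordProj S q.1 q.2
  have hcomm : ∀ a ∈ T, ∀ b ∈ T, a * b = b * a := by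
    rintro _ ⟨q, rfl⟩ _ ⟨q', rfl⟩
    exact (h.commute_coordProj _ _ _ _).eq
  have hcomm' : ∀ a ∈ T, ∀ b ∈ T, a * star b = star b * a := by
    rintro _ ⟨q, rfl⟩ _ ⟨q', rfl⟩
    rw [h.star_coordProj]
    exact (h.commute_coordProj _ _ _ _).eq
  have hadj := StarAlgebra.isMulCommutative_adjoin ℂ hcomm hcomm'
  let : CommRing (cstarGenerate T) :=
    (StarAlgebra.adjoin ℂ T).commRingTopologicalClosure fun x y => hadj.is_comm.comm x y
  have : IsClosed (cstarGenerate T : Set B) := cstarGenerate_isClosed T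
  let : CommCStarAlgebra (cstarGenerate T) := { }
  have hmem (n : ℕ) (x : Letter) : coordProj S n x ∈ cstarGenerate T :=
    subset_cstarGenerate T ⟨(n, x), rfl⟩
  obtain ⟨ρ, hρ⟩ := exists_starAlgHom_coordFun (D := cstarGenerate T)
    (fun n x => ⟨coordProj S n x, hmem n x⟩)
    (fun n x => Subtype.ext (h.isIdempotentElem_coordProj n x))
    (fun n => Subtype.ext (by simpa using h.sum_coordProj n))
    (fun n x => Subtype.ext (h.coordProj_mul_coordProj_inv n x))
  refine ⟨(cstarGenerate T).subtype.comp ρ, fun n x => ?_⟩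
  rw [StarAlgHom.comp_apply, hρ]
  rfl

/-- The unitary representation of `Γ` given by the unitaries of the letters. -/
def groupRep {B : Type*} [CStarAlgebra B] {S : Letter → B} (h : IsLetterFamily S) :
    Gam →* unitary B :=
  FreeGroup.lift fun i => ⟨letterUnitary S (i, true),
    h.star_mul_letterUnitary _, h.letterUnitary_mul_star _⟩

theorem groupRep_elt {B : Type*} [CStarAlgebra B] {S : Letter → B} (h : IsLetterFamily S)
    (x : Letter) : (h.groupRep (elt x) : B) = letterUnitary S x := by
  have hof (i : Fin 2) : (h.groupRep (elt (i, true)) : B) = letterUnitary S (i, true) := by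
    show (h.groupRep (FreeGroup.of i) : B) = _
    rw [groupRep, FreeGroup.lift_apply_of]
  rcases x with ⟨i, _ | _⟩
  · rw [show elt (i, false) = (elt (i, true))⁻¹ from (elt_inv (i, true)).symm, map_inv]
    show star (h.groupRep (elt (i, true)) : B) = _
    rw [hof, star_letterUnitary]
    rfl
  · exact hof i

theorem covariant {B : Type*} [CStarAlgebra B] {S : Letter → B} (h : IsLetterFamily S)
    {ρ : C(Boundary, ℂ) →⋆ₐ[ℂ] B} (hρ : ∀ n x, ρ (coordFun n x) = coordProj S n x)
    (γ : Gam) (f : C(Boundary, ℂ)) :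
    ρ (translateFun γ f) = (h.groupRep γ : B) * ρ f * star (h.groupRep γ : B) := by
  refine covariant_of_letters _ _ (fun x n z => ?_) γ f
  rw [hρ, h.groupRep_elt]
  cases n with
  | zero =>
    rw [translateFun_coordFun_zero, h.letterUnitary_conj_coordProj_zero]
    split_ifs <;> simp [hρ]
  | succ n =>
    rw [translateFun_coordFun_succ, h.letterUnitary_conj_coordProj_succ]
    simp [hρ]

/-- The covariant representation given by a Cuntz–Krieger family. -/
def covariantRep {B : Type} [CStarAlgebra B] [Nontrivial B] {S : Letter → B}
    (h : IsLetterFamily S) : CovariantRep Gam Boundary where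
  carrier := B
  ρ := h.exists_starAlgHom.choose
  π := h.groupRep
  covariant := h.covariant h.exists_starAlgHom.choose_spec

theorem toRep_r {B : Type} [CStarAlgebra B] [Nontrivial B] {S : Letter → B}
    (h : IsLetterFamily S) (x : Letter) : CrossedProduct.toRep h.covariantRep (r x) = S x := by
  rw [r_eq, map_mul, CrossedProduct.toRep_ofFun, CrossedProduct.toRep_ofGroup, map_sub, map_one]
  show (h.groupRep (elt x) : B) * (1 - h.exists_starAlgHom.choose (coordFun 0 (inv x))) = S x
  rw [h.exists_starAlgHom.choose_spec, h.groupRep_elt, h.letterUnitary_mul_one_sub]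

end IsLetterFamily

/-! ### The isomorphism with the Cuntz–Krieger algebra -/

theorem isCuntzKriegerFamily_r : IsCuntzKriegerFamily M fun i => r (letter i) :=
  (isCuntzKriegerFamily_iff r).mpr isLetterFamily_r

theorem range_r_letter : (Set.range fun i => r (letter i)) = Set.range r :=
  letterEquiv.surjective.range_comp r

/-- A covariant representation, as a Cuntz–Krieger family for `M`. -/
def cuntzKriegerRep (R : CovariantRep Gam Boundary) : CuntzKriegerRep M where
  carrier := R.carrier
  s i := CrossedProduct.toRep R (r (letter i))
  isFamily := isCuntzKriegerFamily_r.map (CrossedProduct.toRep R)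

/-- A Cuntz–Krieger family for `M`, with the letters as indices. -/
def letterFamily (R : CuntzKriegerRep M) (x : Letter) : R.carrier := R.s (letterEquiv.symm x)

theorem letterFamily_letter (R : CuntzKriegerRep M) (i : Fin 4) :
    letterFamily R (letter i) = R.s i :=
  congrArg R.s (letterEquiv.symm_apply_apply i)

theorem isLetterFamily_letterFamily (R : CuntzKriegerRep M) :
    IsLetterFamily (letterFamily R) :=
  (isCuntzKriegerFamily_iff _).mp (by simpa only [letterFamily_letter] using R.isFamily)

/-- The homomorphism `C(Ω) ⋊ Γ → 𝒪_M` that maps `r_x` to `S_x`, into the product of all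
Cuntz–Krieger families. -/
def toCuntzKriegerProduct : Alg →⋆ₐ[ℂ] lp (fun R : CuntzKriegerRep M => R.carrier) ∞ :=
  starAlgHomToBoundedProduct fun R =>
    CrossedProduct.toRep (isLetterFamily_letterFamily R).covariantRep

theorem toCuntzKriegerProduct_r (i : Fin 4) :
    toCuntzKriegerProduct (r (letter i)) = cuntzKriegerGen M i := by
  ext R
  exact ((isLetterFamily_letterFamily R).toRep_r _).trans (letterFamily_letter R i)

/-- The homomorphism `𝒪_M → C(Ω) ⋊ Γ` that maps `S_x` to `r_x`, into the product of all covariant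
representations. -/
def toCovariantProduct : CuntzKriegerAlgebra M →⋆ₐ[ℂ] CovariantProduct Gam Boundary :=
  starAlgHomToBoundedProduct fun R => CuntzKriegerAlgebra.toRep (cuntzKriegerRep R)

theorem toCovariantProduct_gen (i : Fin 4) :
    toCovariantProduct (CuntzKriegerAlgebra.gen M i) =
      CrossedProduct.toProduct Gam Boundary (r (letter i)) := rfl

/-- The homomorphism `C(Ω) ⋊ Γ → 𝒪_M` that maps `r_x` to `S_x`. -/
def toCuntzKrieger : Alg →⋆ₐ[ℂ] CuntzKriegerAlgebra M :=
  toCuntzKriegerProduct.codRestrict (cstarGenerate (Set.range (cuntzKriegerGen M))) <|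
    -- The image lies in the closed subalgebra 𝒪_M because the images of the generating r_x do.
    starAlgHom_mem_of_cstarGenerate_eq_top (range_r_letter ▸ cstarGenerate_range_r) _
      (cstarGenerate_isClosed _) <| by
        rintro _ ⟨i, rfl⟩
        rw [toCuntzKriegerProduct_r]
        exact subset_cstarGenerate _ ⟨i, rfl⟩

theorem toCuntzKrieger_r (i : Fin 4) :
    toCuntzKrieger (r (letter i)) = CuntzKriegerAlgebra.gen M i :=
  Subtype.ext (toCuntzKriegerProduct_r i)

/-- The homomorphism `𝒪_M → C(Ω) ⋊ Γ` that maps `S_x` to `r_x`. -/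
def ofCuntzKrieger : CuntzKriegerAlgebra M →⋆ₐ[ℂ] Alg :=
  toCovariantProduct.codRestrict (cstarGenerate
    (Set.range (covariantFun Gam Boundary) ∪ Set.range (covariantGroup Gam Boundary))) <|
    starAlgHom_mem_of_cstarGenerate_eq_top (CuntzKriegerAlgebra.cstarGenerate_range_gen M) _
      (cstarGenerate_isClosed _) <| by
        rintro _ ⟨i, rfl⟩
        rw [toCovariantProduct_gen]
        exact (r (letter i)).2

theorem ofCuntzKrieger_gen (i : Fin 4) :
    ofCuntzKrieger (CuntzKriegerAlgebra.gen M i) = r (letter i) :=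
  Subtype.ext (toCovariantProduct_gen i)

/-- The isomorphism `𝒪_M ≃ C(Ω) ⋊ Γ`. -/
def cuntzKriegerEquiv : CuntzKriegerAlgebra M ≃⋆ₐ[ℂ] Alg :=
  StarAlgEquiv.ofStarAlgHom ofCuntzKrieger toCuntzKrieger
    (starAlgHom_ext_of_cstarGenerate_eq_top (CuntzKriegerAlgebra.cstarGenerate_range_gen M) _ _ <| by
      rintro _ ⟨i, rfl⟩
      show toCuntzKrieger (ofCuntzKrieger _) = _
      rw [ofCuntzKrieger_gen, toCuntzKrieger_r]
      rfl)
    (starAlgHom_ext_of_cstarGenerate_eq_top (range_r_letter ▸ cstarGenerate_range_r) _ _ <| by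
      rintro _ ⟨i, rfl⟩
      show ofCuntzKrieger (toCuntzKrieger _) = _
      rw [toCuntzKrieger_r, ofCuntzKrieger_gen]
      rfl)

end FreeBoundary

end

theorem mainTheorem3 :
    IsCuntzKriegerFamily FreeBoundary.M (fun i => FreeBoundary.r (FreeBoundary.letter i)) ∧
    cstarGenerate {z : FreeBoundary.Alg |
      ∃ u v : FreeBoundary.Gam, FreeBoundary.SameFinalLetter u v ∧ z = FreeBoundary.s u v} = ⊤ ∧
    cstarGenerate (Set.range fun i => FreeBoundary.r (FreeBoundary.letter i)) = ⊤ ∧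
    ∃ φ : CuntzKriegerAlgebra FreeBoundary.M ≃⋆ₐ[ℂ]
        CrossedProduct FreeBoundary.Gam FreeBoundary.Boundary,
      ∀ i, φ (CuntzKriegerAlgebra.gen FreeBoundary.M i) =
        FreeBoundary.r (FreeBoundary.letter i) :=
  ⟨FreeBoundary.isCuntzKriegerFamily_r, FreeBoundary.cstarGenerate_s,
    FreeBoundary.range_r_letter ▸ FreeBoundary.cstarGenerate_range_r,
    FreeBoundary.cuntzKriegerEquiv, FreeBoundary.ofCuntzKrieger_gen⟩
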